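/- A finite simple graph $G=(V,E)$ on $n$ nodes is a \emph{triangulated Laman graph} (TLG) if it is triangulated (every cycle of length greater than $3$ has a chord) and minimally rigid in the plane (it is generically rigid in $\mathbb{R}^2$, and no edge can be removed without losing this property). Let $G$ be a TLG. Its derived graph $D_G$ has the triangles of $G$ as nodes, two distinct triangles being adjacent if they share an edge of $G$. For a node $v$ of $G$, $D_G(v)$ is the subgraph of $D_G$ induced by the triangles containing $v$. A \emph{bottleneck} in $D_G(v)$ for a triangle $\Delta$ is a node of $D_G(v)$ that is contained in every walk in $D_G$ from a node of $D_G(v)$ to $\Delta$. To each triangle $\Delta$ assign nonnegative weights $a_{\Delta,v}$, $v\in\Delta$, with $\sum_{v\in\Delta}a_{\Delta,v}=1$, such that $a_{\Delta,x}+a_{\Delta,y}>0$ whenever $(x,y)$ is an edge of $\Delta$ that also belongs to another triangle. Let $A_\Delta$ be the stochastic $V\times V$ matrix with $(A_\Delta)_{x,y}=a_{\Delta,y}$ if $x,y\in\Delta$, and which agrees with the identity matrix in its other entries. For adjacent triangles $S,T$ with shared edge $(x,y)$ put $r_{S,T}=\frac{a_{T,x}+a_{T,y}}{a_{S,x}+a_{S,y}}$,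 and for a finite walk $\gamma=\gamma_1\cdots\gamma_m$ in $D_G$ let $R_\gamma=\prod_{p=1}^{m-1}r_{\gamma_p,\gamma_{p+1}}$ (so $R_\gamma=1$ if $m=1$). An infinite walk $\gamma_1\gamma_2\cdots$ in $D_G$ is \emph{exhaustive} if it visits every node of $D_G$ infinitely often; let $P_\gamma=\lim_{t\to\infty}A_{\gamma_t}\cdots A_{\gamma_2}A_{\gamma_1}$ when the limit exists. \textbf{Theorem.} For every triangle $\Delta$ and every node $v$ there is exactly one bottleneck in $D_G(v)$ for $\Delta$. Any two nodes of $D_G$ are joined by a walk in $D_G$, and $R_\gamma$ depends only on the first and the last node of $\gamma$. Hence there is exactly one family of vectors $w_\Delta\in\mathbb{R}^V$, indexed by the triangles, such that $w_{\Delta,v}=a_{\Delta,v}$ if $v\in\Delta$, and $w_{\Delta,v}=a_{B,v}R_\gamma$ if $v\notin\Delta$, where $B$ is the bottleneck in $D_G(v)$ for $\Delta$ and $\gamma$ is any walk in $D_G$ from $B$ to $\Delta$. These vectors are nonnegative and nonzero. Put $\overline w_\Delta=w_\Delta/\sum_{v}w_{\Delta,v}$. Then the $\overline w_\Delta$ are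 probability vectors such that, for every triangle $\Delta$ and every infinite exhaustive walk $\gamma$ starting at $\Delta$, the limit $P_\gamma$ exists and equals $\mathbf 1\,\overline w_\Delta^\top$. If $n\ge 4$, they are the only family of probability vectors with this property. -/

import Mathlib

open Filter Topology

namespace TLG

/-! ### Triangulated Laman graphs -/

/-- Every cycle of length greater than three has a chord: an edge of the graph joining two vertices
of the cycle which are not consecutive in it. -/
def IsTriangulated {V : Type*} (G : SimpleGraph V) : Prop :=
  ∀ (v : V) (c : G.Walk v v), c.IsCycle → 3 < c.length →
    ∃ x ∈ c.support, ∃ y ∈ c.support, G.Adj x y ∧ s(x, y) ∉ c.edges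

/-- The velocity assignment `u` of the framework `(G, p)` in the plane preserves
all edge lengths to first order. -/
def IsInfinitesimalMotion {V : Type*} (G : SimpleGraph V)
    (p u : V → EuclideanSpace ℝ (Fin 2)) : Prop :=
  ∀ v w : V, G.Adj v w → inner ℝ (p v - p w) (u v - u w) = 0

/-- The velocity assignment `u` is the superposition of a translation and
an infinitesimal rotation of the points `p`. -/
def IsTrivialMotion {V : Type*} (p u : V → EuclideanSpace ℝ (Fin 2)) : Prop :=
  ∃ (t : EuclideanSpace ℝ (Fin 2)) (ω : ℝ), ∀ v : V,
    u v 0 = t 0 - ω * p v 1 ∧ u v 1 = t 1 + ω * p v 0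

/-- (Generic) rigidity in dimension two: the graph has an infinitesimally rigid placement in the
plane. (A maximal-rank condition, so if one placement has this property then so do all
generic ones.) -/
def IsRigid {V : Type*} (G : SimpleGraph V) : Prop :=
  ∃ p : V → EuclideanSpace ℝ (Fin 2), ∀ u : V → EuclideanSpace ℝ (Fin 2),
    IsInfinitesimalMotion G p u → IsTrivialMotion p u

/-- Rigid, and no edge can be removed without losing rigidity. -/
def IsMinimallyRigid {V : Type*} (G : SimpleGraph V) : Prop :=
  IsRigid G ∧ ∀ e ∈ G.edgeSet, ¬ IsRigid (G.deleteEdges {e})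

/-- Triangulated Laman graphs. -/
def IsTLG {V : Type*} (G : SimpleGraph V) : Prop :=
  IsTriangulated G ∧ IsMinimallyRigid G

/-! ### The derived graph and bottlenecks -/

/-- The triangles of `G`, as sets of three pairwise adjacent vertices. -/
abbrev Triangle {V : Type*} (G : SimpleGraph V) : Type _ := {s : Finset V // G.IsNClique 3 s}

/-- The derived graph: distinct triangles are adjacent when they share an edge. -/
def derivedGraph {V : Type*} (G : SimpleGraph V) : SimpleGraph (Triangle G) where
  Adj S T := S ≠ T ∧ ∃ x y : V, G.Adj x y ∧ (x ∈ S.1 ∧ y ∈ S.1) ∧ (x ∈ T.1 ∧ y ∈ T.1)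
  symm := ⟨fun _ _ h => ⟨h.1.symm, h.2.imp fun _ h => h.imp fun _ h => ⟨h.1, h.2.2, h.2.1⟩⟩⟩
  loopless := ⟨fun _ h => h.1 rfl⟩

/-- The subgraph of the derived graph induced by the triangles containing the vertex `v`. -/
def derivedAt {V : Type*} (G : SimpleGraph V) (v : V) : (derivedGraph G).Subgraph :=
  (⊤ : (derivedGraph G).Subgraph).induce {T | v ∈ T.1}

/-- `b` is a bottleneck in the subgraph `H` for `α`: it is a node of `H`, and it lies on every walk
of the ambient graph from a node of `H` to `α`. -/
def IsBottleneck {W : Type*} {D : SimpleGraph W} (H : D.Subgraph) (α b : W) : Prop :=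
  b ∈ H.verts ∧ ∀ x ∈ H.verts, ∀ p : D.Walk x α, b ∈ p.support

/-! ### Local weights, local stochastic matrices and their products -/

/-- Local weights: `a T v` is the weight of the vertex `v` in the triangle `T`; on each triangle
they form a probability vector. The values `a T v` with `v ∉ T` are irrelevant. -/
def IsLocalWeight {V : Type*} {G : SimpleGraph V} (a : Triangle G → V → ℝ) : Prop :=
  ∀ T : Triangle G, (∀ v ∈ T.1, 0 ≤ a T v) ∧ ∑ v ∈ T.1, a T v = 1

/-- For each triangle and each of its nonsimple edges (that is, those that also belong to another
triangle), the sum of the weights of the two ends is positive. -/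
def PosOnNonsimple {V : Type*} {G : SimpleGraph V} (a : Triangle G → V → ℝ) : Prop :=
  ∀ (T : Triangle G) (x y : V), x ∈ T.1 → y ∈ T.1 → x ≠ y →
    (∃ S : Triangle G, S ≠ T ∧ x ∈ S.1 ∧ y ∈ S.1) → 0 < a T x + a T y

/-- The local stochastic matrix of a triangle. -/
def localMatrix {V : Type*} [DecidableEq V] {G : SimpleGraph V} (a : Triangle G → V → ℝ)
    (T : Triangle G) : Matrix V V ℝ :=
  Matrix.of fun j k =>
    if j ∈ T.1 then (if k ∈ T.1 then a T k else 0) else (if j = k then 1 else 0)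

/-- The product of the local stochastic matrices of the first `t` nodes of a sequence of triangles,
where later matrices multiply from the left. -/
def partialProduct {V : Type*} [Fintype V] [DecidableEq V] {G : SimpleGraph V}
    (a : Triangle G → V → ℝ) (γ : ℕ → Triangle G) : ℕ → Matrix V V ℝ
  | 0 => 1
  | t + 1 => localMatrix a (γ t) * partialProduct a γ t

/-- An infinite walk that visits every node infinitely often. -/
def IsExhaustiveWalk {W : Type*} (D : SimpleGraph W) (γ : ℕ → W) : Prop :=
  (∀ t, D.Adj (γ t) (γ (t + 1))) ∧ ∀ α : W, ∀ N : ℕ, ∃ t, N ≤ t ∧ γ t = α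

/-- `wbar` is a family of probability vectors, indexed by the triangles, such that the product along
every infinite exhaustive walk starting at `T` converges to the matrix all of whose
rows are `wbar T`. -/
def IsLimitFamily {V : Type*} [Fintype V] [DecidableEq V] {G : SimpleGraph V}
    (a : Triangle G → V → ℝ) (wbar : Triangle G → V → ℝ) : Prop :=
  ∀ T : Triangle G, wbar T ∈ stdSimplex ℝ V ∧
    ∀ γ : ℕ → Triangle G, IsExhaustiveWalk (derivedGraph G) γ → γ 0 = T →
      Tendsto (partialProduct a γ) atTop (𝓝 (Matrix.vecMulVec (fun _ => 1) (wbar T)))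

/-! ### The unnormalized vectors -/

/-- The ratio `r` for the step from `S` to an adjacent triangle `T`: the weights of the two ends of
the shared edge, summed in `T`, over the same sum in `S`. -/
noncomputable def edgeRatio {V : Type*} [DecidableEq V] {G : SimpleGraph V}
    (a : Triangle G → V → ℝ) (S T : Triangle G) : ℝ :=
  (∑ v ∈ S.1 ∩ T.1, a T v) / (∑ v ∈ S.1 ∩ T.1, a S v)

/-- The product of the ratios along a finite walk in the derived graph. -/
noncomputable def walkRatio {V : Type*} [DecidableEq V] {G : SimpleGraph V}
    (a : Triangle G → V → ℝ) {S T : Triangle G} (p : (derivedGraph G).Walk S T) : ℝ :=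
  (p.darts.map fun d => edgeRatio a d.fst d.snd).prod

/-- The defining property of the unnormalized vectors `w T`. -/
def IsUnnormalizedFamily {V : Type*} [DecidableEq V] {G : SimpleGraph V}
    (a : Triangle G → V → ℝ) (w : Triangle G → V → ℝ) : Prop :=
  ∀ (T : Triangle G) (v : V),
    (v ∈ T.1 → w T v = a T v) ∧
    (v ∉ T.1 → ∀ B : Triangle G, IsBottleneck (derivedAt G v) T B →
      ∀ p : (derivedGraph G).Walk B T, w T v = a B v * walkRatio a p)

/-- A vector divided by the sum of its entries. -/
noncomputable def normalize {V : Type*} [Fintype V] (x : V → ℝ) : V → ℝ :=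
  fun v => x v / ∑ j, x j

end TLG

/-!
# Local averaging along exhaustive walks on triangulated Laman graphs

*Combinatorics.* A minimally rigid graph in the plane has no four-clique, because the products of
the coefficients of an affine relation between four points are a self-stress of the four-clique,
which makes one of its edges redundant (`IsMinimallyRigid.cliqueFree`); and it has at least
`2 n - 3` edges (`IsRigid.card_le`). A triangulated graph can be dismantled by removing
simplicial vertices (`IsTriangulated.exists_simplicial`). Each of them has at most two neighbours
when it is removed, and the edge count forces exactly two: a triangulated Laman graph is a
two-tree (`IsTLG.isTwoTree_univ`). The triangles of a two-tree can be attached one at a time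
(`IsTwoTree.triangle_induction`). By this induction the derived graph is connected, every vertex
`v` has a gate function (`IsTwoTree.exists_isGate`), which sends a triangle `T` to its bottleneck in
the subgraph of the triangles at `v`, and the ratios `r S T` are of the form `φ T / φ S` for a
positive function `φ` (`IsTwoTree.exists_potential`). So the unnormalized vectors are
`w T v = a (g v T) v * φ T / φ (g v T)`, where `g v T` is the gate.

*Analysis.* From this formula, `w Tᵀ A S = (φ T / φ S) • w Sᵀ` for adjacent triangles `S` and `T`
(`sum_unnormalized_mul_averagingStep`), so the normalized vectors are carried into each other:
`W Tᵀ A S = W Sᵀ`. Let `z` evolve by averaging along an exhaustive walk `γ`. The mean of `z t` with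
respect to `W (γ t)` is constant, and the mean square is decreasing by the variance on the current
triangle, up to a factor that is bounded below. Hence these variances tend to zero, and so do the
differences of consecutive averages (`IsHarmonicFamily.tendsto_average_sub`). If they are at most
`ε` from time `N` on, then the convex hull of the values on the vertices visited since time `N`
grows by at most `ε` for each newly visited vertex, and so never gets longer than `ε n`
(`exists_Icc_of_average_close`). Once all vertices have been visited, all values are within `ε n` of
the conserved mean. No lower bound on the individual weights, and no bound on the return times
of the walk, is needed.
-/

namespace TLG

/-! ### Simplicial vertices of triangulated graphs -/

/-- The graph on all of `V` whose edges are the edges of `G` with both ends in `W`. -/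
def edgesWithin {V : Type*} (G : SimpleGraph V) (W : Set V) : SimpleGraph V where
  Adj x y := G.Adj x y ∧ x ∈ W ∧ y ∈ W
  symm := ⟨fun _ _ h => ⟨h.1.symm, h.2.2, h.2.1⟩⟩
  loopless := ⟨fun _ h => h.1.ne rfl⟩

lemma edgesWithin_le {V : Type*} (G : SimpleGraph V) (W : Set V) : edgesWithin G W ≤ G :=
  fun _ _ h => h.1

lemma mem_of_mem_support_edgesWithin {V : Type*} {G : SimpleGraph V} {W : Set V} {s t : V}
    (p : (edgesWithin G W).Walk s t) (hs : s ∈ W) : ∀ x ∈ p.support, x ∈ W := by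
  induction p with
  | nil => simpa using hs
  | cons h p ih =>
    intro x hx
    rw [SimpleGraph.Walk.support_cons, List.mem_cons] at hx
    rcases hx with rfl | hx
    · exact hs
    · exact ih h.2.2 x hx

/-- Geodesics are induced: two adjacent vertices on a shortest walk are consecutive in it. -/
lemma mem_edges_of_length_eq_dist {V : Type*} {H : SimpleGraph V} {s t : V} (p : H.Walk s t)
    (hp : p.length = H.dist s t) {x y : V} (hx : x ∈ p.support) (hy : y ∈ p.support)
    (hxy : H.Adj x y) : s(x, y) ∈ p.edges := by
  obtain ⟨i, rfl, hi⟩ := SimpleGraph.Walk.mem_support_iff_exists_getVert.1 hx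
  obtain ⟨j, rfl, hj⟩ := SimpleGraph.Walk.mem_support_iff_exists_getVert.1 hy
  have key : ∀ i j : ℕ, i < j → j ≤ p.length → H.Adj (p.getVert i) (p.getVert j) →
      s(p.getVert i, p.getVert j) ∈ p.edges := by
    intro i j hij hj hadj
    have h := SimpleGraph.dist_le ((p.take i).append (.cons hadj (p.drop j)))
    simp only [SimpleGraph.Walk.length_append, SimpleGraph.Walk.length_cons,
      SimpleGraph.Walk.take_length, SimpleGraph.Walk.drop_length] at h
    obtain rfl : j = i + 1 := by omega
    rw [SimpleGraph.Walk.mk_mem_edges_iff_exists]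
    exact ⟨i, by omega, rfl⟩
  rcases lt_trichotomy i j with h | h | h
  · exact key i j h hj hxy
  · subst h
    exact absurd rfl hxy.ne
  · rw [Sym2.eq_swap]
    exact key j i h hi hxy.symm

/-- Two neighbours of `v` joined by a walk that otherwise avoids `v` and its neighbours are
adjacent, since a geodesic between them closes up through `v` to a cycle without a chord. -/
lemma IsTriangulated.adj_of_reachable {V : Type*} {G : SimpleGraph V} (hG : IsTriangulated G)
    {v s t : V} {W : Set V} (hs : G.Adj v s) (ht : G.Adj v t) (hst : s ≠ t) (hsW : s ∈ W)
    (hv : v ∉ W) (hW : ∀ w ∈ W, G.Adj v w → w = s ∨ w = t)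
    (hr : (edgesWithin G W).Reachable s t) : G.Adj s t := by
  by_contra hadj
  obtain ⟨p, hp, hlen⟩ := hr.exists_path_of_dist
  have hpW := mem_of_mem_support_edgesWithin p hsW
  have hvp : v ∉ p.support := fun h => hv (hpW v h)
  set q := p.mapLe (edgesWithin_le G W) with hq
  have hqs : q.support = p.support := by simp [hq]
  have hqe : q.edges = p.edges := by simp [hq]
  have hcyc : (SimpleGraph.Walk.cons hs (q.concat ht.symm)).IsCycle := by
    rw [SimpleGraph.Walk.cons_isCycle_iff]
    refine ⟨SimpleGraph.Walk.IsPath.concat ?_ (hqs ▸ hvp) _, ?_⟩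
    · rw [SimpleGraph.Walk.isPath_def, hqs]
      exact hp.support_nodup
    · rw [SimpleGraph.Walk.edges_concat, List.concat_eq_append, List.mem_append, hqe]
      rintro (h | h)
      · exact hvp (p.fst_mem_support_of_mem_edges h)
      · rw [List.mem_singleton, Sym2.eq_swap (a := t), Sym2.congr_right] at h
        exact hst h
  have hlen2 : 2 ≤ p.length := by
    by_contra h
    have h01 : p.length = 0 ∨ p.length = 1 := by omega
    rcases h01 with h | h
    · exact hst (SimpleGraph.Walk.eq_of_length_eq_zero h)
    · exact hadj (SimpleGraph.Walk.adj_of_length_eq_one h).1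
  obtain ⟨x, hx, y, hy, hxy, hne⟩ := hG v _ hcyc (by simp [hq]; omega)
  have hmem : ∀ z, z ∈ (SimpleGraph.Walk.cons hs (q.concat ht.symm)).support →
      z = v ∨ z ∈ p.support := by
    intro z hz
    simp only [SimpleGraph.Walk.support_cons, SimpleGraph.Walk.support_concat, hqs,
      List.mem_cons, List.mem_append, List.not_mem_nil, or_false] at hz
    tauto
  have hend : ∀ z, z ∈ p.support → G.Adj v z →
      s(v, z) ∈ (SimpleGraph.Walk.cons hs (q.concat ht.symm)).edges := by
    intro z hz hvz
    rcases hW z (hpW z hz) hvz with rfl | rfl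
    · simp
    · simp [SimpleGraph.Walk.edges_concat, Sym2.eq_swap]
  rcases hmem x hx with rfl | hx' <;> rcases hmem y hy with rfl | hy'
  · exact hxy.ne rfl
  · exact hne (hend y hy' hxy)
  · exact hne (Sym2.eq_swap ▸ hend x hx' hxy.symm)
  · refine hne ?_
    have := mem_edges_of_length_eq_dist p hlen hx' hy' ⟨hxy, hpW x hx', hpW y hy'⟩
    simp [SimpleGraph.Walk.edges_concat, hqe, this]

/-- **Dirac's lemma**, in the form that allows an induction: the subgraph induced on a finite set
`U` has a simplicial vertex outside of any clique `K` that does not exhaust `U`. -/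
lemma IsTriangulated.exists_simplicial {V : Type*} [DecidableEq V] {G : SimpleGraph V}
    (hG : IsTriangulated G) (U K : Finset V) (hKU : K ⊂ U) (hK : G.IsClique K) :
    ∃ z ∈ U, z ∉ K ∧ G.IsClique {x | x ∈ U ∧ G.Adj z x} := by
  classical
  induction U using Finset.strongInduction generalizing K with
  | H U ih =>
  by_cases hU : G.IsClique U
  · obtain ⟨z, hzU, hzK⟩ := Finset.exists_of_ssubset hKU
    exact ⟨z, hzU, hzK, hU.subset fun x hx => hx.1⟩
  -- a vertex `v` of `U` with a non-neighbour `c` in `U`, whose closed neighbourhood contains `K`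
  obtain ⟨v, hvU, c, hcU, hvc, hnadj, hKv⟩ : ∃ v ∈ U, ∃ c ∈ U, v ≠ c ∧ ¬ G.Adj v c ∧
      ∀ k ∈ K, k ≠ v → G.Adj v k := by
    by_cases hex : ∃ v ∈ K, ∃ c ∈ U, v ≠ c ∧ ¬ G.Adj v c
    · obtain ⟨v, hvK, c, hcU, h1, h2⟩ := hex
      exact ⟨v, hKU.1 hvK, c, hcU, h1, h2, fun k hk hkv => hK hvK hk hkv.symm⟩
    · push Not at hex
      rw [SimpleGraph.IsClique, Set.Pairwise] at hU
      push Not at hU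
      obtain ⟨v, hv, c, hc, h1, h2⟩ := hU
      exact ⟨v, hv, c, hc, h1, h2, fun k hk hkv => (hex k hk v hv hkv).symm⟩
  -- the component `C` of `c` among the vertices outside the closed neighbourhood of `v`
  let F : Set V := {x | x ∈ U ∧ x ≠ v ∧ ¬ G.Adj v x}
  let C : Set V := {x | x ∈ F ∧ (edgesWithin G F).Reachable c x}
  have hcC : c ∈ C := ⟨⟨hcU, hvc.symm, hnadj⟩, .rfl⟩
  have hCadj : ∀ x ∈ C, ∀ y ∈ F, G.Adj x y → y ∈ C := fun x hx y hy hxy =>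
    ⟨hy, hx.2.trans (SimpleGraph.Adj.reachable ⟨hxy, hx.1, hy⟩)⟩
  let S : Finset V := U.filter fun s => G.Adj v s ∧ ∃ x ∈ C, G.Adj x s
  let U' : Finset V := U.filter fun x => x ∈ C ∨ x ∈ S
  have hCU' : ∀ x ∈ C, x ∈ U' := fun x hx => Finset.mem_filter.2 ⟨hx.1.1, .inl hx⟩
  have hSclique : G.IsClique (S : Set V) := by
    intro s hs t ht hst
    obtain ⟨-, hvs, x, hxC, hxs⟩ := Finset.mem_filter.1 (Finset.mem_coe.1 hs)
    obtain ⟨-, hvt, y, hyC, hyt⟩ := Finset.mem_filter.1 (Finset.mem_coe.1 ht)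
    refine hG.adj_of_reachable (W := F ∪ {s, t}) hvs hvt hst (by simp) ?_ ?_ ?_
    · rintro (h | h | h)
      · exact h.2.1 rfl
      · exact hvs.ne h
      · exact hvt.ne h
    · rintro w (h | h) hvw
      · exact absurd hvw h.2.2
      · exact h
    · have hFle : edgesWithin G F ≤ edgesWithin G (F ∪ {s, t}) :=
        fun p q h => ⟨h.1, .inl h.2.1, .inl h.2.2⟩
      have hxy : (edgesWithin G (F ∪ {s, t})).Reachable x y :=
        (hxC.2.symm.trans hyC.2).mono hFle
      have hsx : (edgesWithin G (F ∪ {s, t})).Adj s x := ⟨hxs.symm, by simp, .inl hxC.1⟩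
      have hyt' : (edgesWithin G (F ∪ {s, t})).Adj y t := ⟨hyt, .inl hyC.1, by simp⟩
      exact (hsx.reachable.trans hxy).trans hyt'.reachable
  have hSC : ∀ x ∈ C, x ∉ S := fun x hx h => hx.1.2.2 (Finset.mem_filter.1 h).2.1
  have hvU' : v ∉ U' := by
    intro h
    rcases (Finset.mem_filter.1 h).2 with h | h
    · exact h.1.2.1 rfl
    · exact (Finset.mem_filter.1 h).2.1.ne rfl
  obtain ⟨z, hzU', hzS, hz⟩ := ih U' (Finset.ssubset_iff_of_subset (Finset.filter_subset _ _) |>.2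
    ⟨v, hvU, hvU'⟩) S
    (Finset.ssubset_iff_of_subset (fun s hs => Finset.mem_filter.2
      ⟨(Finset.mem_filter.1 hs).1, .inr hs⟩) |>.2 ⟨c, hCU' c hcC, hSC c hcC⟩) hSclique
  have hzC : z ∈ C := (Finset.mem_filter.1 hzU').2.resolve_right hzS
  refine ⟨z, hzC.1.1, fun hzK => hzC.1.2.2 (hKv z hzK hzC.1.2.1), hz.subset ?_⟩
  -- all neighbours of `z` in `U` lie in `C` or in its boundary `S`
  rintro x ⟨hxU, hzx⟩
  refine ⟨Finset.mem_filter.2 ⟨hxU, ?_⟩, hzx⟩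
  by_cases hxF : x ∈ F
  · exact .inl (hCadj z hzC x hxF hzx)
  · have hxv : x ≠ v := fun h => hzC.1.2.2 (h ▸ hzx.symm)
    have hvx : G.Adj v x := by
      by_contra h
      exact hxF ⟨hxU, hxv, h⟩
    exact .inr (Finset.mem_filter.2 ⟨hxU, hvx, z, hzC, hzx⟩)

/-! ### Rigidity: the edge count and the absence of four-cliques -/

/-- Any four points of the plane satisfy a nontrivial affine relation. -/
lemma exists_affine_relation (q : Fin 4 → EuclideanSpace ℝ (Fin 2)) :
    ∃ l : Fin 4 → ℝ, l ≠ 0 ∧ ∑ i, l i = 0 ∧ ∀ k, ∑ i, l i * q i k = 0 := by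
  let f : (Fin 4 → ℝ) →ₗ[ℝ] (ℝ × (Fin 2 → ℝ)) :=
    { toFun := fun l => (∑ i, l i, fun k => ∑ i, l i * q i k)
      map_add' := fun l m => by
        ext <;> simp [add_mul, Finset.sum_add_distrib]
      map_smul' := fun c l => by
        ext <;> simp [Finset.mul_sum, mul_assoc] }
  have hker : LinearMap.ker f ≠ ⊥ := f.ker_ne_bot_of_finrank_lt (by simp)
  obtain ⟨l, hl, hl0⟩ := (Submodule.ne_bot_iff _).1 hker
  have hfl : f l = 0 := hl
  exact ⟨l, hl0, congrArg Prod.fst hfl, fun k => congrFun (congrArg Prod.snd hfl) k⟩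

/-- The products of the coefficients of an affine relation form a self-stress of the complete graph
on the points. -/
lemma stress_of_affine_relation (q u : Fin 4 → EuclideanSpace ℝ (Fin 2)) (l : Fin 4 → ℝ)
    (h0 : ∑ i, l i = 0) (h1 : ∀ k, ∑ i, l i * q i k = 0) :
    ∑ i, ∑ j, l i * l j * inner ℝ (q i - q j) (u i - u j) = 0 := by
  have hx := h1 0
  have hy := h1 1
  simp only [Fin.sum_univ_four, PiLp.inner_apply, Fin.sum_univ_two, PiLp.sub_apply,
    RCLike.inner_apply, conj_trivial] at *
  linear_combination
    2 * (l 0 * (u 0 0 * q 0 0 + u 0 1 * q 0 1) + l 1 * (u 1 0 * q 1 0 + u 1 1 * q 1 1) +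
      l 2 * (u 2 0 * q 2 0 + u 2 1 * q 2 1) + l 3 * (u 3 0 * q 3 0 + u 3 1 * q 3 1)) * h0 -
    2 * (l 0 * u 0 0 + l 1 * u 1 0 + l 2 * u 2 0 + l 3 * u 3 0) * hx -
    2 * (l 0 * u 0 1 + l 1 * u 1 1 + l 2 * u 2 1 + l 3 * u 3 1) * hy

lemma IsMinimallyRigid.cliqueFree {V : Type*} {G : SimpleGraph V} (hG : IsMinimallyRigid G) :
    G.CliqueFree 4 := by
  classical
  rw [SimpleGraph.cliqueFree_iff]
  refine ⟨fun f => ?_⟩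
  have hf : ∀ i j : Fin 4, i ≠ j → G.Adj (f i) (f j) := fun i j hij =>
    f.toHom.map_adj hij
  obtain ⟨⟨p, hp⟩, hmin⟩ := hG
  obtain ⟨l, hl, h0, h1⟩ := exists_affine_relation fun i => p (f i)
  obtain ⟨i, hi⟩ : ∃ i, l i ≠ 0 := Function.ne_iff.1 hl
  -- two of the coefficients are nonzero, since their sum vanishes
  obtain ⟨j, hji, hj⟩ : ∃ j, j ≠ i ∧ l j ≠ 0 := by
    by_contra! h
    rw [Finset.sum_eq_single i (fun j _ hj => h j hj) (by simp)] at h0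
    exact hi h0
  refine hmin s(f i, f j) (hf i j hji.symm) ⟨p, fun u hu => hp u ?_⟩
  have hstress := stress_of_affine_relation (fun i => p (f i)) (fun i => u (f i)) l h0 h1
  have hzero : ∀ x y : Fin 4, s(x, y) ≠ s(i, j) →
      l x * l y * inner ℝ (p (f x) - p (f y)) (u (f x) - u (f y)) = 0 := by
    intro x y hxy
    rcases eq_or_ne x y with rfl | hne
    · simp
    · rw [hu (f x) (f y) ((SimpleGraph.deleteEdges_adj).2 ⟨hf x y hne, fun h => hxy ?_⟩), mul_zero]
      exact Sym2.map.injective f.injective h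
  have hij : inner ℝ (p (f i) - p (f j)) (u (f i) - u (f j)) = 0 := by
    rw [Fintype.sum_eq_add i j hji.symm, Fintype.sum_eq_single j, Fintype.sum_eq_single i] at hstress
    · rw [← neg_sub (p (f i)) (p (f j)), ← neg_sub (u (f i)) (u (f j)), inner_neg_neg,
        mul_comm (l j) (l i), ← two_mul] at hstress
      simpa [hi, hj] using hstress
    · intro y hy
      exact hzero j y fun h => hy (by rwa [Sym2.eq_swap, Sym2.congr_left] at h)
    · intro y hy
      exact hzero i y fun h => hy (Sym2.congr_right.1 h)
    · rintro x ⟨hxi, hxj⟩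
      refine Finset.sum_eq_zero fun y _ => hzero x y fun h => ?_
      rcases Sym2.eq_iff.1 h with h | h
      · exact hxi h.1
      · exact hxj h.1
  intro v w hvw
  by_cases h : s(v, w) = s(f i, f j)
  · rcases Sym2.eq_iff.1 h with ⟨rfl, rfl⟩ | ⟨rfl, rfl⟩
    · exact hij
    · rw [← neg_sub (p (f i)), ← neg_sub (u (f i)), inner_neg_neg]
      exact hij
  · exact hu v w ((SimpleGraph.deleteEdges_adj).2 ⟨hvw, h⟩)

/-- The linear parametrization of the trivial motions of a placement. -/
noncomputable def trivialMotions {V : Type*} (p : V → EuclideanSpace ℝ (Fin 2)) :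
    (Fin 3 → ℝ) →ₗ[ℝ] (V → EuclideanSpace ℝ (Fin 2)) where
  toFun c v := !₂[c 0 - c 2 * p v 1, c 1 + c 2 * p v 0]
  map_add' c d := by
    ext v k
    fin_cases k <;> simp <;> ring
  map_smul' r c := by
    ext v k
    fin_cases k <;> simp <;> ring

/-- The rigidity map of a framework: half the first-order change of the squared edge lengths. The ends
of an edge are taken in an arbitrary order, which does not affect the value. -/
noncomputable def rigidityMap {V : Type*} (G : SimpleGraph V) (p : V → EuclideanSpace ℝ (Fin 2)) :
    (V → EuclideanSpace ℝ (Fin 2)) →ₗ[ℝ] (G.edgeSet → ℝ) where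
  toFun u e := inner ℝ (p (Quot.out e.1).1 - p (Quot.out e.1).2)
    (u (Quot.out e.1).1 - u (Quot.out e.1).2)
  map_add' u v := by
    ext e
    simp only [Pi.add_apply, ← inner_add_right]
    congr 1
    abel
  map_smul' r u := by
    ext e
    simp only [Pi.smul_apply, ← smul_sub, inner_smul_right, RingHom.id_apply, smul_eq_mul]

lemma isInfinitesimalMotion_of_rigidityMap_eq_zero {V : Type*} {G : SimpleGraph V}
    {p u : V → EuclideanSpace ℝ (Fin 2)} (h : rigidityMap G p u = 0) :
    IsInfinitesimalMotion G p u := by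
  intro v w hvw
  have he : (fun e : G.edgeSet => inner ℝ (p (Quot.out e.1).1 - p (Quot.out e.1).2)
    (u (Quot.out e.1).1 - u (Quot.out e.1).2)) ⟨s(v, w), hvw⟩ = 0 := congrFun h _
  have ho : s((Quot.out s(v, w)).1, (Quot.out s(v, w)).2) = s(v, w) := Quot.out_eq s(v, w)
  rcases Sym2.eq_iff.1 ho with ⟨h1, h2⟩ | ⟨h1, h2⟩
  · simpa only [h1, h2] using he
  · simp only [h1, h2] at he
    rw [← neg_sub (p w), ← neg_sub (u w), inner_neg_neg]
    exact he

/-- The count of Maxwell: there are at least as many edges as degrees of freedom minus three. -/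
lemma IsRigid.card_le {V : Type*} [Fintype V] {G : SimpleGraph V} (hG : IsRigid G) :
    2 * Fintype.card V ≤ Nat.card G.edgeSet + 3 := by
  classical
  obtain ⟨p, hp⟩ := hG
  have hle : LinearMap.ker (rigidityMap G p) ≤ LinearMap.range (trivialMotions p) := by
    intro u hu
    obtain ⟨t, ω, h⟩ := hp u (isInfinitesimalMotion_of_rigidityMap_eq_zero hu)
    refine ⟨![t 0, t 1, ω], ?_⟩
    ext v k
    fin_cases k
    · simp [trivialMotions, (h v).1]
    · simp [trivialMotions, (h v).2]
  have h1 := Submodule.finrank_mono hle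
  have h2 := LinearMap.finrank_range_le (trivialMotions p)
  have h3 := (rigidityMap G p).finrank_range_add_finrank_ker
  have h4 := Submodule.finrank_le (LinearMap.range (rigidityMap G p))
  have h5 : Module.finrank ℝ (V → EuclideanSpace ℝ (Fin 2)) = Fintype.card V * 2 := by
    rw [Module.finrank_pi_fintype]
    simp
  have h6 : Module.finrank ℝ (G.edgeSet → ℝ) = Nat.card G.edgeSet := by
    rw [Module.finrank_fintype_fun_eq_card, Nat.card_eq_fintype_card]
  have h7 : Module.finrank ℝ (Fin 3 → ℝ) = 3 := by simp
  omega

/-! ### Triangulated Laman graphs are two-trees -/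

/-- The set `U` of vertices induces a two-tree in `G`: it is built from a triangle by repeatedly
adding a vertex whose neighbours among the present vertices are the two ends of an edge. -/
inductive IsTwoTree {V : Type*} [DecidableEq V] (G : SimpleGraph V) : Finset V → Prop
  | triangle {s : Finset V} : G.IsNClique 3 s → IsTwoTree G s
  | cons {U : Finset V} {x y z : V} : IsTwoTree G U → z ∉ U → x ∈ U → y ∈ U → G.Adj x y →
      (∀ w ∈ U, G.Adj z w ↔ w = x ∨ w = y) → IsTwoTree G (insert z U)

/-- The number of ordered pairs of adjacent vertices of `U`, which is twice the number of edges
that `U` induces. -/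
def dartCount {V : Type*} (G : SimpleGraph V) [DecidableRel G.Adj] (U : Finset V) : ℕ :=
  ∑ x ∈ U, ∑ y ∈ U, if G.Adj x y then 1 else 0

lemma dartCount_insert {V : Type*} [DecidableEq V] (G : SimpleGraph V) [DecidableRel G.Adj]
    {U : Finset V} {z : V} (hz : z ∉ U) :
    dartCount G (insert z U) = dartCount G U + 2 * (U.filter (G.Adj z)).card := by
  simp only [dartCount, Finset.sum_insert hz, Finset.sum_add_distrib, SimpleGraph.irrefl,
    if_false, Finset.card_filter, G.adj_comm _ z]
  ring

/-- A triangulated graph without four-cliques that has as many edges on `U` as a two-tree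
is a two-tree on `U`: peeling off a simplicial vertex removes at most two edges, and the count
leaves no room for fewer. -/
lemma IsTriangulated.isTwoTree {V : Type*} [DecidableEq V] {G : SimpleGraph V}
    [DecidableRel G.Adj] (hG : IsTriangulated G) (h4 : G.CliqueFree 4) (U : Finset V)
    (hU : 3 ≤ U.card) (hc : 4 * U.card ≤ dartCount G U + 6) :
    IsTwoTree G U ∧ dartCount G U + 6 = 4 * U.card := by
  induction U using Finset.strongInduction with
  | H U ih =>
  rcases hU.eq_or_lt with h3 | h3
  · obtain ⟨x, y, z, hxy, hxz, hyz, rfl⟩ := Finset.card_eq_three.1 h3.symm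
    rw [← h3] at hc ⊢
    have hcount : dartCount G {x, y, z} = 2 * ((if G.Adj x y then 1 else 0) +
        (if G.Adj x z then 1 else 0) + (if G.Adj y z then 1 else 0)) := by
      rw [dartCount_insert G (by simp [hxy, hxz]), dartCount_insert G (by simp [hyz])]
      simp only [Finset.card_filter, Finset.sum_insert, Finset.mem_singleton, hyz, not_false_eq_true,
        Finset.sum_singleton, dartCount, SimpleGraph.irrefl, if_false]
      ring
    rw [hcount] at hc ⊢
    split_ifs at hc ⊢ with h1 h2 h3 <;> try omega
    exact ⟨.triangle (SimpleGraph.is3Clique_triple_iff.2 ⟨h1, h2, h3⟩), rfl⟩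
  · obtain ⟨z, hzU, -, hz⟩ := hG.exists_simplicial U ∅
      (Finset.empty_ssubset.2 (Finset.card_pos.1 (by omega))) (by simp)
    have hzU' := Finset.notMem_erase z U
    have hins := dartCount_insert G hzU'
    rw [Finset.insert_erase hzU] at hins
    have hcard := Finset.card_erase_add_one hzU
    set N := (U.erase z).filter (G.Adj z) with hN
    have hNclique : ∀ x ∈ N, ∀ y ∈ N, x ≠ y → G.Adj x y := fun x hx y hy hxy => by
      simp only [hN, Finset.mem_filter, Finset.mem_erase] at hx hy
      exact hz ⟨hx.1.2, hx.2⟩ ⟨hy.1.2, hy.2⟩ hxy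
    have hN2 : N.card ≤ 2 := by
      by_contra h
      obtain ⟨t, htN, ht⟩ := Finset.exists_subset_card_eq (show 3 ≤ N.card by omega)
      have ht3 : G.IsNClique 3 t :=
        ⟨fun x hx y hy hxy => hNclique x (htN hx) y (htN hy) hxy, ht⟩
      exact h4 _ (ht3.insert fun b hb => (Finset.mem_filter.1 (htN hb)).2)
    obtain ⟨ht, he⟩ := ih (U.erase z) (Finset.erase_ssubset hzU) (by omega) (by omega)
    obtain ⟨x, y, hxy, hNxy⟩ := Finset.card_eq_two.1 (show N.card = 2 by omega)
    have hx : x ∈ N := by simp [hNxy]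
    have hy : y ∈ N := by simp [hNxy]
    refine ⟨?_, by omega⟩
    rw [← Finset.insert_erase hzU]
    refine .cons ht hzU' (Finset.mem_filter.1 hx).1 (Finset.mem_filter.1 hy).1
      (hNclique x hx y hy hxy) fun w hw => ?_
    have : w ∈ N ↔ w = x ∨ w = y := by simp [hNxy]
    rw [← this, hN, Finset.mem_filter]
    exact ⟨fun h => ⟨hw, h⟩, fun h => h.2⟩

lemma IsTLG.isTwoTree_univ {V : Type*} [Fintype V] [DecidableEq V] {G : SimpleGraph V}
    (hG : IsTLG G) (h3 : 3 ≤ Fintype.card V) : IsTwoTree G Finset.univ := by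
  classical
  refine (hG.1.isTwoTree hG.2.cliqueFree Finset.univ (by simpa using h3) ?_).1
  have h1 := hG.2.1.card_le
  have h2 := G.sum_degrees_eq_twice_card_edges
  have h5 : dartCount G Finset.univ = ∑ v, G.degree v := by
    simp only [dartCount, ← Finset.card_filter, ← SimpleGraph.card_neighborFinset_eq_degree,
      SimpleGraph.neighborFinset_eq_filter]
  rw [Nat.card_eq_fintype_card, ← SimpleGraph.edgeFinset_card] at h1
  rw [h5, Finset.card_univ]
  omega

/-! ### Growing the derived graph triangle by triangle -/

lemma card_inter_eq_two {V : Type*} [DecidableEq V] {G : SimpleGraph V} {S T : Triangle G}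
    (h : (derivedGraph G).Adj S T) : (S.1 ∩ T.1).card = 2 := by
  obtain ⟨hne, x, y, hxy, hS, hT⟩ := h
  have h1 : ({x, y} : Finset V) ⊆ S.1 ∩ T.1 := by
    intro w hw
    rcases Finset.mem_insert.1 hw with rfl | hw
    · exact Finset.mem_inter.2 ⟨hS.1, hT.1⟩
    · rw [Finset.mem_singleton.1 hw]
      exact Finset.mem_inter.2 ⟨hS.2, hT.2⟩
  have h2 := Finset.card_le_card h1
  rw [Finset.card_pair hxy.ne] at h2
  refine le_antisymm ?_ h2
  by_contra h3
  have e1 : S.1 ∩ T.1 = S.1 :=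
    Finset.eq_of_subset_of_card_le Finset.inter_subset_left (by rw [S.2.card_eq]; omega)
  have e2 : S.1 ∩ T.1 = T.1 :=
    Finset.eq_of_subset_of_card_le Finset.inter_subset_right (by rw [T.2.card_eq]; omega)
  exact hne (Subtype.ext (e1.symm.trans e2))

lemma IsTwoTree.exists_triangle_of_adj {V : Type*} [DecidableEq V] {G : SimpleGraph V}
    {U : Finset V} (h : IsTwoTree G U) {p q : V} (hp : p ∈ U) (hq : q ∈ U) (hpq : G.Adj p q) :
    ∃ R : Triangle G, R.1 ⊆ U ∧ p ∈ R.1 ∧ q ∈ R.1 := by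
  induction h with
  | triangle hs => exact ⟨⟨_, hs⟩, subset_rfl, hp, hq⟩
  | @cons U x y z hU hz hx hy hxy hN ih =>
    by_cases hpqU : p ∈ U ∧ q ∈ U
    · obtain ⟨R, hR, h⟩ := ih hpqU.1 hpqU.2
      exact ⟨R, hR.trans (Finset.subset_insert _ _), h⟩
    · refine ⟨⟨{z, x, y}, SimpleGraph.is3Clique_triple_iff.2
        ⟨(hN x hx).2 (.inl rfl), (hN y hy).2 (.inr rfl), hxy⟩⟩, ?_, ?_⟩
      · intro w hw
        simp only [Finset.mem_insert, Finset.mem_singleton] at hw ⊢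
        rcases hw with rfl | rfl | rfl <;> simp [*]
      · have hNp := hN p
        have hNq := hN q
        simp only [Finset.mem_insert, Finset.mem_singleton] at hp hq ⊢
        rcases hp with rfl | hp <;> rcases hq with rfl | hq
        · exact absurd rfl hpq.ne
        · exact ⟨.inl rfl, .inr ((hNq hq).1 hpq)⟩
        · exact ⟨.inr ((hNp hp).1 hpq.symm), .inl rfl⟩
        · exact absurd ⟨hp, hq⟩ hpqU

lemma IsTwoTree.exists_triangle_of_mem {V : Type*} [DecidableEq V] {G : SimpleGraph V}
    {U : Finset V} (h : IsTwoTree G U) {v : V} (hv : v ∈ U) : ∃ R : Triangle G, v ∈ R.1 := by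
  induction h with
  | triangle hs => exact ⟨⟨_, hs⟩, hv⟩
  | @cons U x y z hU hz hx hy hxy hN ih =>
    rcases Finset.mem_insert.1 hv with rfl | hv
    · exact ⟨⟨{v, x, y}, SimpleGraph.is3Clique_triple_iff.2
        ⟨(hN x hx).2 (.inl rfl), (hN y hy).2 (.inr rfl), hxy⟩⟩, by simp⟩
    · exact ih hv

/-- The triangle `L` is attached to the set `𝒮` of triangles along the edge `e` of `R ∈ 𝒮`: its
third vertex is new, and all the triangles of `𝒮` that are adjacent to `L` have `e` in common. -/
structure IsAttached {V : Type*} [DecidableEq V] {G : SimpleGraph V} (𝒮 : Set (Triangle G))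
    (L R : Triangle G) (e : Finset V) : Prop where
  notMem : L ∉ 𝒮
  mem : R ∈ 𝒮
  adj : (derivedGraph G).Adj R L
  new : ∀ S ∈ 𝒮, ∀ v ∈ L.1, v ∈ S.1 → v ∈ e
  inter : ∀ S ∈ 𝒮, (derivedGraph G).Adj S L → S.1 ∩ L.1 = e
  inter' : ∀ S ∈ 𝒮, (derivedGraph G).Adj S L → S ≠ R →
    (derivedGraph G).Adj R S ∧ R.1 ∩ S.1 = e

/-- Induction over the triangles of a two-tree, attached one at a time. -/
lemma IsTwoTree.triangle_induction {V : Type*} [DecidableEq V] {G : SimpleGraph V}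
    {P : Set (Triangle G) → Prop} (single : ∀ T, P {T})
    (attach : ∀ 𝒮 L R e, IsAttached 𝒮 L R e → P 𝒮 → P (insert L 𝒮))
    {U : Finset V} (h : IsTwoTree G U) : P {T | T.1 ⊆ U} := by
  induction h with
  | @triangle s hs =>
    convert single ⟨s, hs⟩ using 1
    ext T
    simp only [Set.mem_ofPred_eq, Set.mem_singleton_iff, Subtype.ext_iff]
    exact ⟨fun h => Finset.eq_of_subset_of_card_le h (by rw [hs.card_eq, T.2.card_eq]),
      fun h => h.subset⟩
  | @cons U x y z hU hz hx hy hxy hN ih =>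
    obtain ⟨R, hRU, hxR, hyR⟩ := hU.exists_triangle_of_adj hx hy hxy
    let L : Triangle G := ⟨{z, x, y}, SimpleGraph.is3Clique_triple_iff.2
        ⟨(hN x hx).2 (.inl rfl), (hN y hy).2 (.inr rfl), hxy⟩⟩
    have hzL : z ∈ L.1 := by simp [L]
    have hxL : x ∈ L.1 := by simp [L]
    have hyL : y ∈ L.1 := by simp [L]
    have hL : ¬ L.1 ⊆ U := fun h => hz (h hzL)
    have hset : {T : Triangle G | T.1 ⊆ insert z U} = insert L {T | T.1 ⊆ U} := by
      ext T
      simp only [Set.mem_ofPred_eq, Set.mem_insert_iff]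
      constructor
      · intro hT
        by_cases hzT : z ∈ T.1
        · refine .inl (Subtype.ext (Finset.eq_of_subset_of_card_le (fun w hw => ?_) ?_))
          · rcases eq_or_ne w z with rfl | hwz
            · exact hzL
            · have := (hN w ((Finset.mem_insert.1 (hT hw)).resolve_left hwz)).1
                (T.2.1 hzT hw hwz.symm)
              rcases this with rfl | rfl
              · exact hxL
              · exact hyL
          · rw [L.2.card_eq, T.2.card_eq]
        · exact .inr ((Finset.subset_insert_iff_of_notMem hzT).1 hT)
      · rintro (rfl | hT)
        · intro w hw
          simp only [L, Finset.mem_insert, Finset.mem_singleton] at hw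
          rcases hw with rfl | rfl | rfl <;> simp [*]
        · exact hT.trans (Finset.subset_insert _ _)
    have hnew : ∀ S : Triangle G, S.1 ⊆ U → ∀ v ∈ L.1, v ∈ S.1 → v ∈ ({x, y} : Finset V) := by
      intro S hS v hvL hvS
      simp only [L, Finset.mem_insert, Finset.mem_singleton] at hvL ⊢
      exact hvL.resolve_left fun h => hz (h ▸ hS hvS)
    have hinter : ∀ S : Triangle G, S.1 ⊆ U → (derivedGraph G).Adj S L →
        S.1 ∩ L.1 = {x, y} := fun S hS hSL =>
      Finset.eq_of_subset_of_card_le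
        (fun v hv => hnew S hS v (Finset.mem_inter.1 hv).2 (Finset.mem_inter.1 hv).1)
        (by rw [card_inter_eq_two hSL, Finset.card_pair hxy.ne])
    rw [hset]
    refine attach _ L R {x, y} ⟨hL, hRU, ⟨fun h => hL (h ▸ hRU), x, y, hxy, ⟨hxR, hyR⟩, hxL, hyL⟩,
      hnew, hinter, fun S hS hSL hSR => ?_⟩ ih
    have hxyS : ∀ w ∈ ({x, y} : Finset V), w ∈ S.1 := fun w hw => by
      rw [← hinter S hS hSL] at hw
      exact (Finset.mem_inter.1 hw).1
    have hRS : (derivedGraph G).Adj R S :=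
      ⟨hSR.symm, x, y, hxy, ⟨hxR, hyR⟩, hxyS x (by simp), hxyS y (by simp)⟩
    refine ⟨hRS, (Finset.eq_of_subset_of_card_le (fun w hw => ?_) ?_).symm⟩
    · refine Finset.mem_inter.2 ⟨?_, hxyS w hw⟩
      rcases Finset.mem_insert.1 hw with rfl | hw
      · exact hxR
      · rwa [Finset.mem_singleton.1 hw]
    · rw [card_inter_eq_two hRS, Finset.card_pair hxy.ne]

lemma IsTwoTree.reachable {V : Type*} [DecidableEq V] {G : SimpleGraph V} {U : Finset V}
    (h : IsTwoTree G U) : ∀ S T : Triangle G, S.1 ⊆ U → T.1 ⊆ U →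
      (derivedGraph G).Reachable S T := by
  have := h.triangle_induction
    (P := fun 𝒮 => ∀ S ∈ 𝒮, ∀ T ∈ 𝒮, (derivedGraph G).Reachable S T) ?_ ?_
  · exact fun S T hS hT => this S hS T hT
  · rintro T S rfl T rfl
    rfl
  · intro 𝒮 L R e hatt ih
    have hL : ∀ S ∈ 𝒮, (derivedGraph G).Reachable S L := fun S hS =>
      (ih S hS R hatt.mem).trans hatt.adj.reachable
    rintro S (rfl | hS) T (rfl | hT)
    · rfl
    · exact (hL T hT).symm
    · exact hL S hS
    · exact ih S hS T hT

/-! ### Gates and potentials -/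

/-- A gate function for the vertex `v` on a set `𝒮` of triangles: it sends each triangle to a
triangle at `v`, fixes the triangles at `v`, and is constant along the edges of the derived
graph that do not lie in the subgraph of the triangles at `v`. -/
structure IsGate {V : Type*} {G : SimpleGraph V} (𝒮 : Set (Triangle G)) (v : V)
    (g : Triangle G → Triangle G) : Prop where
  mem : ∀ T ∈ 𝒮, v ∈ (g T).1
  fixed : ∀ T ∈ 𝒮, v ∈ T.1 → g T = T
  const : ∀ S ∈ 𝒮, ∀ T ∈ 𝒮, (derivedGraph G).Adj S T → ¬ (v ∈ S.1 ∧ v ∈ T.1) → g S = g T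

lemma IsTwoTree.exists_isGate {V : Type*} [DecidableEq V] {G : SimpleGraph V} {U : Finset V}
    (h : IsTwoTree G U) (v : V) (hv : ∃ S : Triangle G, S.1 ⊆ U ∧ v ∈ S.1) :
    ∃ g, IsGate {T : Triangle G | T.1 ⊆ U} v g := by
  revert hv
  refine h.triangle_induction (P := fun 𝒮 => (∃ S ∈ 𝒮, v ∈ S.1) → ∃ g, IsGate 𝒮 v g) ?_ ?_
  · rintro T ⟨S, rfl, hS⟩
    refine ⟨id, ?_, fun _ _ _ => rfl, ?_⟩
    · rintro T rfl
      exact hS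
    · rintro S rfl T rfl h
      exact absurd rfl h.ne
  · intro 𝒮 L R e hatt ih hv
    by_cases hv' : ∃ S ∈ 𝒮, v ∈ S.1
    · obtain ⟨g, hg⟩ := ih hv'
      obtain ⟨S₀, hS₀, hvS₀⟩ := hv'
      have hgne : ∀ T ∈ 𝒮, ∀ M, Function.update g L M T = g T := fun T hT M =>
        Function.update_of_ne (fun h : T = L => hatt.notMem (h ▸ hT)) _ _
      have hSL : ∀ S ∈ 𝒮, (derivedGraph G).Adj S L → ¬ (v ∈ S.1 ∧ v ∈ L.1) →
          g S = if v ∈ L.1 then L else g R := by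
        intro S hS hadj hnot
        have hint := hatt.inter S hS hadj
        split_ifs with hvL
        · have hve := hatt.new S₀ hS₀ v hvL hvS₀
          rw [← hint] at hve
          exact absurd (Finset.mem_inter.1 hve) hnot
        · rcases eq_or_ne S R with rfl | hSR
          · rfl
          · obtain ⟨hRS, hRSe⟩ := hatt.inter' S hS hadj hSR
            refine (hg.const R hatt.mem S hS hRS fun hboth => hvL ?_).symm
            have hve : v ∈ e := hRSe ▸ Finset.mem_inter.2 hboth
            rw [← hint] at hve
            exact (Finset.mem_inter.1 hve).2
      refine ⟨Function.update g L (if v ∈ L.1 then L else g R), ?_, ?_, ?_⟩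
      · rintro T (rfl | hT)
        · rw [Function.update_self]
          split_ifs with hvL
          · exact hvL
          · exact hg.mem R hatt.mem
        · rw [hgne T hT]
          exact hg.mem T hT
      · rintro T (rfl | hT) hvT
        · rw [Function.update_self, if_pos hvT]
        · rw [hgne T hT]
          exact hg.fixed T hT hvT
      · rintro S (rfl | hS) T (rfl | hT) hadj hnot
        · rfl
        · rw [Function.update_self, hgne T hT]
          exact (hSL T hT hadj.symm fun h => hnot h.symm).symm
        · rw [Function.update_self, hgne S hS]
          exact hSL S hS hadj hnot
        · rw [hgne S hS, hgne T hT]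
          exact hg.const S hS T hT hadj hnot
    · -- `v` occurs in the attached triangle only
      obtain ⟨S, rfl | hS, hvS⟩ := hv
      · refine ⟨fun _ => S, fun _ _ => hvS, ?_, fun _ _ _ _ _ _ => rfl⟩
        rintro T (rfl | hT) hvT
        · rfl
        · exact absurd ⟨T, hT, hvT⟩ hv'
      · exact absurd ⟨S, hS, hvS⟩ hv'

/-- The ratios are the coboundary of a positive function on the triangles. A newly
attached triangle is adjacent only to triangles through one edge `e`, and among these the ratio
from `S` to `T` is the weight of `e` in `T` over its weight in `S`, which is already
multiplicative. -/
lemma IsTwoTree.exists_potential {V : Type*} [DecidableEq V] {G : SimpleGraph V} {U : Finset V}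
    (h : IsTwoTree G U) {a : Triangle G → V → ℝ}
    (hpos : ∀ S T, (derivedGraph G).Adj S T → 0 < ∑ v ∈ S.1 ∩ T.1, a S v) :
    ∃ φ : Triangle G → ℝ, (∀ T, 0 < φ T) ∧ ∀ S T : Triangle G, S.1 ⊆ U → T.1 ⊆ U →
      (derivedGraph G).Adj S T → edgeRatio a S T * φ S = φ T := by
  have := h.triangle_induction (P := fun 𝒮 => ∃ φ : Triangle G → ℝ, (∀ T, 0 < φ T) ∧
    ∀ S ∈ 𝒮, ∀ T ∈ 𝒮, (derivedGraph G).Adj S T → edgeRatio a S T * φ S = φ T) ?_ ?_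
  · obtain ⟨φ, h1, h2⟩ := this
    exact ⟨φ, h1, fun S T hS hT => h2 S hS T hT⟩
  · refine fun T => ⟨fun _ => 1, fun _ => one_pos, ?_⟩
    rintro S rfl T rfl h
    exact absurd rfl h.ne
  · rintro 𝒮 L R e hatt ⟨φ, hφ, ih⟩
    have hφne : ∀ T ∈ 𝒮, ∀ r, Function.update φ L r T = φ T := fun T hT M =>
      Function.update_of_ne (fun h : T = L => hatt.notMem (h ▸ hT)) _ _
    have heL : R.1 ∩ L.1 = e := hatt.inter R hatt.mem hatt.adj
    have heR : 0 < ∑ v ∈ e, a R v := heL ▸ hpos R L hatt.adj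
    have heL' : 0 < ∑ v ∈ e, a L v := by
      rw [← heL, Finset.inter_comm]
      exact hpos L R hatt.adj.symm
    -- the potential of a neighbour `S` of `L` relative to that of `R`
    have hS : ∀ S ∈ 𝒮, (derivedGraph G).Adj S L → S.1 ∩ L.1 = e ∧ 0 < ∑ v ∈ e, a S v ∧
        φ S = (∑ v ∈ e, a S v) / (∑ v ∈ e, a R v) * φ R := by
      intro S hS hadj
      have he := hatt.inter S hS hadj
      refine ⟨he, he ▸ hpos S L hadj, ?_⟩
      rcases eq_or_ne S R with rfl | hSR
      · rw [div_self heR.ne', one_mul]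
      · obtain ⟨hRS, hRSe⟩ := hatt.inter' S hS hadj hSR
        rw [← ih R hatt.mem S hS hRS, edgeRatio, hRSe]
    refine ⟨Function.update φ L ((∑ v ∈ e, a L v) / (∑ v ∈ e, a R v) * φ R), fun T => ?_, ?_⟩
    · rcases eq_or_ne T L with rfl | hT
      · rw [Function.update_self]
        exact mul_pos (div_pos heL' heR) (hφ R)
      · rw [Function.update_of_ne hT]
        exact hφ T
    · rintro S (rfl | hS') T (rfl | hT') hadj
      · exact absurd rfl hadj.ne
      · obtain ⟨h1, h2, h3⟩ := hS T hT' hadj.symm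
        rw [Function.update_self, hφne T hT', h3, edgeRatio, Finset.inter_comm, h1]
        field_simp
      · obtain ⟨h1, h2, h3⟩ := hS S hS' hadj
        rw [Function.update_self, hφne S hS', h3, edgeRatio, h1]
        field_simp
      · rw [hφne S hS', hφne T hT']
        exact ih S hS' T hT' hadj

/-! ### Convergence of averaging along exhaustive walks -/

section Averaging

variable {V : Type*} {G : SimpleGraph V} {a : Triangle G → V → ℝ}

/-- The weighted average over the triangle `T` of a function on the vertices. -/
def average (a : Triangle G → V → ℝ) (T : Triangle G) (f : V → ℝ) : ℝ :=
  ∑ v ∈ T.1, a T v * f v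

/-- Replaces the values of `f` on the triangle `T` by their weighted average; this is the action of
the local stochastic matrix of `T` on column vectors. -/
def averagingStep [DecidableEq V] (a : Triangle G → V → ℝ) (T : Triangle G) (f : V → ℝ) : V → ℝ :=
  fun v => if v ∈ T.1 then average a T f else f v

lemma localMatrix_mulVec [Fintype V] [DecidableEq V] (a : Triangle G → V → ℝ) (T : Triangle G)
    (f : V → ℝ) : (localMatrix a T).mulVec f = averagingStep a T f := by
  ext v
  simp only [Matrix.mulVec, dotProduct, localMatrix, Matrix.of_apply, averagingStep, average]
  split_ifs with hv
  · simp only [ite_mul, zero_mul]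
    rw [← Finset.sum_filter]
    congr 1
    ext w
    simp
  · simp

lemma averagingStep_of_mem [DecidableEq V] {T : Triangle G} {v : V} (hv : v ∈ T.1) (f : V → ℝ) :
    averagingStep a T f v = average a T f := if_pos hv

lemma averagingStep_of_notMem [DecidableEq V] {T : Triangle G} {v : V} (hv : v ∉ T.1)
    (f : V → ℝ) : averagingStep a T f v = f v := if_neg hv

lemma average_mem_Icc (ha : IsLocalWeight a) (T : Triangle G) {f : V → ℝ} {l u : ℝ}
    (hf : ∀ v ∈ T.1, f v ∈ Set.Icc l u) : average a T f ∈ Set.Icc l u := by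
  have h := (convex_Icc l u).sum_mem (ha T).1 (ha T).2 hf
  simpa only [smul_eq_mul, average] using h

lemma average_sq_sub_sq (ha : IsLocalWeight a) (T : Triangle G) (f : V → ℝ) :
    average a T (fun v => f v ^ 2) - average a T f ^ 2 =
      ∑ v ∈ T.1, a T v * (f v - average a T f) ^ 2 := by
  have h : ∀ c : ℝ, ∑ v ∈ T.1, a T v * (f v - c) ^ 2 =
      average a T (fun v => f v ^ 2) - 2 * c * average a T f + c ^ 2 * ∑ v ∈ T.1, a T v := by
    intro c
    simp only [average, Finset.mul_sum, ← Finset.sum_sub_distrib, ← Finset.sum_add_distrib]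
    exact Finset.sum_congr rfl fun v _ => by ring
  rw [h, (ha T).2]
  ring

/-- If consecutive averages differ by at most `ε` from time `N` on, then the values on the set of
vertices visited since time `N` stay in an interval: by the convexity of averages it grows, by at
most `ε`, only when a new vertex is visited. -/
lemma exists_Icc_of_average_close [DecidableEq V] (ha : IsLocalWeight a)
    {γ : ℕ → Triangle G} {z : ℕ → V → ℝ}
    (hz : ∀ t, z (t + 1) = averagingStep a (γ t) (z t)) {ε : ℝ} (hε : 0 ≤ ε) (N : ℕ)
    (hN : ∀ t ≥ N, |average a (γ (t + 1)) (z (t + 1)) - average a (γ t) (z t)| ≤ ε) (k : ℕ) :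
    ∃ l u : ℝ, u - l ≤ ε * ((Finset.range (k + 1)).biUnion fun i => (γ (N + i)).1).card ∧
      ∀ v ∈ (Finset.range (k + 1)).biUnion fun i => (γ (N + i)).1,
        z (N + k + 1) v ∈ Set.Icc l u := by
  induction k with
  | zero =>
    refine ⟨average a (γ N) (z N), average a (γ N) (z N), ?_, fun v hv => ?_⟩
    · rw [sub_self]
      positivity
    · have hv' : v ∈ (γ N).1 := by simpa using hv
      rw [Nat.add_zero, hz N, averagingStep_of_mem hv']
      exact ⟨le_rfl, le_rfl⟩
  | succ k ih =>
    obtain ⟨l, u, hlu, hmem⟩ := ih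
    set A := (Finset.range (k + 1)).biUnion fun i => (γ (N + i)).1 with hA
    have hB : ((Finset.range (k + 1 + 1)).biUnion fun i => (γ (N + i)).1) =
        (γ (N + k + 1)).1 ∪ A := by
      rw [Finset.range_add_one, Finset.biUnion_insert]
      rfl
    rw [hB]
    set c := average a (γ (N + k + 1)) (z (N + k + 1)) with hc
    have hval : ∀ l' u' : ℝ, l' ≤ l → u ≤ u' → c ∈ Set.Icc l' u' →
        ∀ v ∈ (γ (N + k + 1)).1 ∪ A, z (N + (k + 1) + 1) v ∈ Set.Icc l' u' := by
      intro l' u' hl hu hc' v hv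
      rw [show N + (k + 1) + 1 = N + k + 1 + 1 from rfl, hz (N + k + 1)]
      by_cases hvγ : v ∈ (γ (N + k + 1)).1
      · rwa [averagingStep_of_mem hvγ]
      · rw [averagingStep_of_notMem hvγ]
        exact Set.Icc_subset_Icc hl hu (hmem v ((Finset.mem_union.1 hv).resolve_left hvγ))
    by_cases hsub : (γ (N + k + 1)).1 ⊆ A
    · rw [Finset.union_eq_right.2 hsub]
      exact ⟨l, u, hlu, fun v hv => hval l u le_rfl le_rfl
        (average_mem_Icc ha _ fun w hw => hmem w (hsub hw)) v (Finset.mem_union_right _ hv)⟩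
    · -- the previous average lies in the interval, and `c` is within `ε` of it
      have hprev : average a (γ (N + k)) (z (N + k)) ∈ Set.Icc l u := by
        obtain ⟨v, hv⟩ : (γ (N + k)).1.Nonempty := by
          rw [← Finset.card_pos, (γ (N + k)).2.card_eq]
          norm_num
        rw [← averagingStep_of_mem hv, ← hz]
        exact hmem v (Finset.mem_biUnion.2 ⟨k, by simp, hv⟩)
      have hclose := abs_le.1 (hN (N + k) (by omega))
      have hcard : (A.card : ℝ) + 1 ≤ ((γ (N + k + 1)).1 ∪ A).card := by
        have : A.card < ((γ (N + k + 1)).1 ∪ A).card := by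
          refine Finset.card_lt_card (Finset.ssubset_iff_subset_ne.2
            ⟨Finset.subset_union_right, fun h => hsub ?_⟩)
          rw [h]
          exact Finset.subset_union_left
        exact_mod_cast this
      refine ⟨min l c, max u c, ?_, hval _ _ (min_le_left _ _) (le_max_left _ _)
        ⟨min_le_right _ _, le_max_right _ _⟩⟩
      have h1 := mul_le_mul_of_nonneg_left hcard hε
      have h2 : max u c - min l c ≤ u - l + ε := by
        rcases max_cases u c with h | h <;> rcases min_cases l c with h' | h' <;>
          linarith [hprev.1, hprev.2, hclose.1, hclose.2]
      linarith

end Averaging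

lemma exists_pos_le_of_finite {α : Type*} [Finite α] (r : α → α → Prop) (f : α → α → ℝ)
    (h : ∀ x y, r x y → 0 < f x y) : ∃ ε > 0, ∀ x y, r x y → ε ≤ f x y := by
  classical
  rcases isEmpty_or_nonempty α with hα | hα
  · exact ⟨1, one_pos, fun x => hα.elim x⟩
  · obtain ⟨⟨x₀, y₀⟩, h₀⟩ := Finite.exists_min fun q : α × α => if r q.1 q.2 then f q.1 q.2 else 1
    refine ⟨_, ?_, fun x y hxy => (h₀ (x, y)).trans_eq (if_pos hxy)⟩
    split_ifs with hr
    · exact h _ _ hr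
    · exact one_pos

section Convergence

variable {V : Type*} [Fintype V] [DecidableEq V] {G : SimpleGraph V} {a : Triangle G → V → ℝ}

/-- Probability vectors that are carried into each other by the local averaging steps: if `S` and
`T` are adjacent, then averaging over `S` turns the mean with respect to `W T` into the mean with
respect to `W S`. -/
structure IsHarmonicFamily (a W : Triangle G → V → ℝ) : Prop where
  mem_stdSimplex : ∀ T, W T ∈ stdSimplex ℝ V
  pos : ∀ S T, (derivedGraph G).Adj S T → 0 < ∑ v ∈ S.1, W T v
  mean_step : ∀ S T, (derivedGraph G).Adj S T → ∀ f : V → ℝ,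
    ∑ v, W T v * averagingStep a S f v = ∑ v, W S v * f v

/-- The mean square with respect to a harmonic family decreases in each step by a multiple of the
variance on the triangle that is averaged over. -/
lemma IsHarmonicFamily.sum_sq_sub {W : Triangle G → V → ℝ} (hW : IsHarmonicFamily a W)
    (ha : IsLocalWeight a) {S T : Triangle G} (hST : (derivedGraph G).Adj S T) (f : V → ℝ) :
    ∑ v, W S v * f v ^ 2 - ∑ v, W T v * averagingStep a S f v ^ 2 =
      (∑ v ∈ S.1, W T v) * ∑ v ∈ S.1, a S v * (f v - average a S f) ^ 2 := by
  rw [← hW.mean_step S T hST (fun v => f v ^ 2), ← average_sq_sub_sq ha, ← Finset.sum_sub_distrib,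
    Finset.sum_mul, ← Finset.sum_subset (Finset.subset_univ S.1)]
  · refine Finset.sum_congr rfl fun v hv => ?_
    rw [averagingStep_of_mem hv, averagingStep_of_mem hv]
    ring
  · intro v _ hv
    rw [averagingStep_of_notMem hv, averagingStep_of_notMem hv, sub_self]

variable {W : Triangle G → V → ℝ} {γ : ℕ → Triangle G} {z : ℕ → V → ℝ}

/-- Consecutive averages along a walk get close to each other, because consecutive triangles share
an edge of positive weight, on which the value is the previous average. -/
lemma IsHarmonicFamily.tendsto_average_sub (hW : IsHarmonicFamily a W) (ha : IsLocalWeight a)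
    (hshare : ∀ S T, (derivedGraph G).Adj S T → 0 < ∑ v ∈ S.1 ∩ T.1, a T v)
    (hγ : ∀ t, (derivedGraph G).Adj (γ t) (γ (t + 1)))
    (hz : ∀ t, z (t + 1) = averagingStep a (γ t) (z t)) :
    Tendsto (fun t => average a (γ (t + 1)) (z (t + 1)) - average a (γ t) (z t)) atTop (𝓝 0) := by
  obtain ⟨κ, hκ, hκle⟩ := exists_pos_le_of_finite _ (fun S T => ∑ v ∈ S.1, W T v) hW.pos
  obtain ⟨δ, hδ, hδle⟩ := exists_pos_le_of_finite _ (fun S T => ∑ v ∈ S.1 ∩ T.1, a T v) hshare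
  set Φ : ℕ → ℝ := fun t => ∑ v, W (γ t) v * z t v ^ 2 with hΦ
  have hdrop : ∀ t, Φ t - Φ (t + 1) = (∑ v ∈ (γ t).1, W (γ (t + 1)) v) *
      ∑ v ∈ (γ t).1, a (γ t) v * (z t v - average a (γ t) (z t)) ^ 2 := fun t => by
    simp only [hΦ, hz t]
    exact hW.sum_sq_sub ha (hγ t) (z t)
  have hvar : ∀ t, 0 ≤ ∑ v ∈ (γ t).1, a (γ t) v * (z t v - average a (γ t) (z t)) ^ 2 := fun t =>
    Finset.sum_nonneg fun v hv => mul_nonneg ((ha _).1 v hv) (sq_nonneg _)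
  have hanti : Antitone Φ := antitone_nat_of_succ_le fun t => by
    have := mul_nonneg (hW.pos _ _ (hγ t)).le (hvar t)
    linarith [hdrop t]
  have hlim := tendsto_atTop_ciInf hanti ⟨0, by
    rintro _ ⟨t, rfl⟩
    exact Finset.sum_nonneg fun v _ => mul_nonneg ((hW.mem_stdSimplex _).1 v) (sq_nonneg _)⟩
  have hdiff : Tendsto (fun t => (Φ (t + 1) - Φ (t + 1 + 1)) / (κ * δ)) atTop (𝓝 0) := by
    have h1 := hlim.comp (tendsto_add_atTop_nat 1)
    have h2 := hlim.comp (tendsto_add_atTop_nat 2)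
    simpa using (h1.sub h2).div_const (κ * δ)
  have hbound : ∀ t, (average a (γ (t + 1)) (z (t + 1)) - average a (γ t) (z t)) ^ 2 ≤
      (Φ (t + 1) - Φ (t + 1 + 1)) / (κ * δ) := by
    intro t
    set d := (average a (γ (t + 1)) (z (t + 1)) - average a (γ t) (z t)) ^ 2
    rw [le_div_iff₀ (mul_pos hκ hδ), hdrop]
    have h1 : d * δ ≤ ∑ v ∈ (γ (t + 1)).1,
        a (γ (t + 1)) v * (z (t + 1) v - average a (γ (t + 1)) (z (t + 1))) ^ 2 := by
      refine (mul_le_mul_of_nonneg_left (hδle _ _ (hγ t)) (sq_nonneg _)).trans ?_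
      rw [Finset.mul_sum]
      refine le_trans (Finset.sum_le_sum fun v hv => ?_)
        (Finset.sum_le_sum_of_subset_of_nonneg Finset.inter_subset_right
          fun v hv _ => mul_nonneg ((ha _).1 v hv) (sq_nonneg _))
      rw [hz t, averagingStep_of_mem (Finset.mem_inter.1 hv).1, ← hz t]
      exact le_of_eq (by ring)
    calc d * (κ * δ) = κ * (d * δ) := by ring
      _ ≤ _ := mul_le_mul (hκle _ _ (hγ (t + 1))) h1 (mul_nonneg (sq_nonneg _) hδ.le)
        (hW.pos _ _ (hγ (t + 1))).le
  have hsq := squeeze_zero (fun t => sq_nonneg _) hbound hdiff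
  have habs := (Real.continuous_sqrt.tendsto 0).comp hsq
  rw [Real.sqrt_zero] at habs
  refine (tendsto_zero_iff_abs_tendsto_zero _).2 (habs.congr fun t => ?_)
  exact Real.sqrt_sq_eq_abs _

/-- Averaging along an exhaustive walk converges to the constant given by the mean of the initial
values, with respect to the vector that a harmonic family assigns to the first triangle. -/
theorem IsHarmonicFamily.tendsto_of_exhaustive (hW : IsHarmonicFamily a W) (ha : IsLocalWeight a)
    (hshare : ∀ S T, (derivedGraph G).Adj S T → 0 < ∑ v ∈ S.1 ∩ T.1, a T v)
    (hcover : ∀ v : V, ∃ T : Triangle G, v ∈ T.1)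
    (hγ : IsExhaustiveWalk (derivedGraph G) γ)
    (hz : ∀ t, z (t + 1) = averagingStep a (γ t) (z t)) (j : V) :
    Tendsto (fun t => z t j) atTop (𝓝 (∑ v, W (γ 0) v * z 0 v)) := by
  have hmean : ∀ t, ∑ v, W (γ t) v * z t v = ∑ v, W (γ 0) v * z 0 v := by
    intro t
    induction t with
    | zero => rfl
    | succ t ih => rw [hz, hW.mean_step _ _ (hγ.1 t), ih]
  have hlim := hW.tendsto_average_sub ha hshare hγ.1 hz
  refine Metric.tendsto_atTop.2 fun ε hε => ?_
  set η : ℝ := ε / (Fintype.card V + 1) with hη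
  have hη0 : 0 < η := by positivity
  obtain ⟨N, hN⟩ := Metric.tendsto_atTop.1 hlim η hη0
  choose τ hτ using fun v => (hcover v).imp fun T hT => (⟨hT, hγ.2 T N⟩ :
    v ∈ T.1 ∧ ∃ t, N ≤ t ∧ γ t = T)
  choose s hs using fun v => (hτ v).2
  refine ⟨N + Finset.univ.sup s + 1, fun t ht => ?_⟩
  obtain ⟨k, rfl⟩ : ∃ k, t = N + k + 1 := ⟨t - N - 1, by omega⟩
  obtain ⟨l, u, hlu, hmem⟩ := exists_Icc_of_average_close ha hz hη0.le N
    (fun t ht => by simpa [Real.dist_eq] using (hN t ht).le) k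
  -- by this time every vertex has been visited since time `N`
  have hall : ((Finset.range (k + 1)).biUnion fun i => (γ (N + i)).1) = Finset.univ := by
    refine Finset.eq_univ_iff_forall.2 fun v => Finset.mem_biUnion.2 ⟨s v - N, ?_, ?_⟩
    · have := Finset.le_sup (f := s) (Finset.mem_univ v)
      rw [Finset.mem_range]
      omega
    · rw [Nat.add_sub_cancel' (hs v).1, (hs v).2]
      exact (hτ v).1
  rw [hall] at hlu hmem
  have hmeanmem : ∑ v, W (γ 0) v * z 0 v ∈ Set.Icc l u := by
    rw [← hmean (N + k + 1)]
    have h := (convex_Icc l u).sum_mem (fun v _ => (hW.mem_stdSimplex (γ (N + k + 1))).1 v)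
      (hW.mem_stdSimplex (γ (N + k + 1))).2 hmem
    simpa only [smul_eq_mul] using h
  have hj := hmem j (Finset.mem_univ j)
  refine (Real.dist_le_of_mem_Icc hj hmeanmem).trans_lt (hlu.trans_lt ?_)
  rw [hη, Finset.card_univ, div_mul_eq_mul_div, div_lt_iff₀ (by positivity)]
  linarith

end Convergence

/-! ### Bottlenecks and the unnormalized vectors -/

section Bottleneck

variable {V : Type*} {G : SimpleGraph V}

/-- The value of a gate function at `T` is a bottleneck for `T`: it does not change along a walk
towards `T` until it equals the node that is being left. -/
lemma IsGate.isBottleneck {v : V} {g : Triangle G → Triangle G} (hg : IsGate Set.univ v g)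
    (T : Triangle G) : IsBottleneck (derivedAt G v) T (g T) := by
  refine ⟨hg.mem T trivial, fun S hS p => ?_⟩
  have key : ∀ {S T : Triangle G} (p : (derivedGraph G).Walk S T),
      g T ∈ p.support ∨ (v ∉ S.1 ∧ g S = g T) := by
    intro S T p
    induction p with
    | nil =>
      rename_i T
      by_cases hv : v ∈ T.1
      · exact .inl (by simp [hg.fixed T trivial hv])
      · exact .inr ⟨hv, rfl⟩
    | cons h p ih =>
      rename_i S R T
      rcases ih with ih | ⟨hR, hRT⟩
      · exact .inl (by simp [ih])
      · have hSR := hg.const S trivial R trivial h fun h => hR h.2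
        by_cases hv : v ∈ S.1
        · exact .inl (by rw [← hRT, ← hSR, hg.fixed S trivial hv]; simp)
        · exact .inr ⟨hv, hSR.trans hRT⟩
  exact (key p).resolve_right fun h => h.1 hS

/-- Of two distinct bottlenecks, each would be strictly closer to the target than the other. -/
lemma IsBottleneck.eq {W : Type*} {D : SimpleGraph W} (hD : D.Preconnected) {H : D.Subgraph}
    {α b c : W} (hb : IsBottleneck H α b) (hc : IsBottleneck H α c) : b = c := by
  classical
  have key : ∀ {b c : W}, IsBottleneck H α b → IsBottleneck H α c → b ≠ c →
      D.dist c α < D.dist b α := by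
    intro b c hb hc hbc
    obtain ⟨p, hp⟩ := (hD b α).exists_walk_length_eq_dist
    have hcp := hc.2 b hb.1 p
    have hlen := congrArg SimpleGraph.Walk.length (p.take_spec hcp)
    rw [SimpleGraph.Walk.length_append] at hlen
    have h1 := SimpleGraph.dist_le (p.dropUntil c hcp)
    have h2 : (p.takeUntil c hcp).length ≠ 0 := fun h =>
      hbc (SimpleGraph.Walk.eq_of_length_eq_zero h)
    omega
  by_contra hbc
  exact lt_asymm (key hb hc hbc) (key hc hb (Ne.symm hbc))

variable {a w : Triangle G → V → ℝ} {g : V → Triangle G → Triangle G} {φ : Triangle G → ℝ}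

lemma unnormalized_nonneg (ha : IsLocalWeight a) (hg : ∀ v, IsGate Set.univ v (g v))
    (hφ : ∀ T, 0 < φ T) (hw : ∀ T v, w T v = a (g v T) v * (φ T / φ (g v T)))
    (T : Triangle G) (v : V) : 0 ≤ w T v := by
  rw [hw]
  exact mul_nonneg ((ha _).1 v ((hg v).mem T trivial)) (div_pos (hφ _) (hφ _)).le

lemma sum_unnormalized_pos [Fintype V] (ha : IsLocalWeight a) (hg : ∀ v, IsGate Set.univ v (g v))
    (hφ : ∀ T, 0 < φ T) (hw : ∀ T v, w T v = a (g v T) v * (φ T / φ (g v T)))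
    (T : Triangle G) : 0 < ∑ v, w T v := by
  have h1 : ∑ v ∈ T.1, w T v = 1 := by
    rw [← (ha T).2]
    refine Finset.sum_congr rfl fun v hv => ?_
    rw [hw, (hg v).fixed T trivial hv, div_self (hφ T).ne', mul_one]
  have h2 := Finset.sum_le_sum_of_subset_of_nonneg (Finset.subset_univ T.1)
    fun v _ _ => unnormalized_nonneg ha hg hφ hw T v
  linarith

variable [DecidableEq V]

lemma sum_inter_pos (ha : IsLocalWeight a) (hpos : PosOnNonsimple a) {S T : Triangle G}
    (h : (derivedGraph G).Adj S T) : 0 < ∑ v ∈ S.1 ∩ T.1, a S v := by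
  obtain ⟨hne, x, y, hxy, hS, hT⟩ := h
  have h1 := hpos S x y hS.1 hS.2 hxy.ne ⟨T, hne.symm, hT⟩
  rw [← Finset.sum_pair hxy.ne] at h1
  refine h1.trans_le (Finset.sum_le_sum_of_subset_of_nonneg (fun v hv => ?_)
    fun v hv _ => (ha S).1 v (Finset.mem_inter.1 hv).1)
  rcases Finset.mem_insert.1 hv with rfl | hv
  · exact Finset.mem_inter.2 ⟨hS.1, hT.1⟩
  · rw [Finset.mem_singleton.1 hv]
    exact Finset.mem_inter.2 ⟨hS.2, hT.2⟩

lemma walkRatio_eq_div (hφ : ∀ T, 0 < φ T)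
    (hratio : ∀ S T, (derivedGraph G).Adj S T → edgeRatio a S T * φ S = φ T)
    {S T : Triangle G} (p : (derivedGraph G).Walk S T) : walkRatio a p = φ T / φ S := by
  rw [eq_div_iff (hφ S).ne']
  induction p with
  | nil => simp [walkRatio]
  | cons h p ih =>
    rw [← ih, ← hratio _ _ h]
    simp only [walkRatio, SimpleGraph.Walk.darts_cons, List.map_cons, List.prod_cons]
    ring

/-- With gates and a potential, the defining property of the unnormalized vectors becomes
a single formula, also for the vertices of the triangle itself. -/
lemma isUnnormalizedFamily_iff (hD : (derivedGraph G).Preconnected)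
    (hg : ∀ v, IsGate Set.univ v (g v)) (hφ : ∀ T, 0 < φ T)
    (hratio : ∀ S T, (derivedGraph G).Adj S T → edgeRatio a S T * φ S = φ T)
    (w : Triangle G → V → ℝ) :
    IsUnnormalizedFamily a w ↔ ∀ T v, w T v = a (g v T) v * (φ T / φ (g v T)) := by
  refine forall₂_congr fun T v => ?_
  by_cases hv : v ∈ T.1
  · simp [hv, (hg v).fixed T trivial hv, (hφ T).ne']
  · simp only [hv, false_imp_iff, not_false_eq_true, true_imp_iff, true_and]
    constructor
    · intro h
      obtain ⟨p⟩ := hD (g v T) T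
      rw [h _ ((hg v).isBottleneck T) p, walkRatio_eq_div hφ hratio]
    · intro h B hB p
      obtain rfl := hB.eq hD ((hg v).isBottleneck T)
      rw [h, walkRatio_eq_div hφ hratio]

lemma sum_unnormalized_eq_div (ha : IsLocalWeight a) (hpos : PosOnNonsimple a)
    (hg : ∀ v, IsGate Set.univ v (g v)) (hφ : ∀ T, 0 < φ T)
    (hratio : ∀ S T, (derivedGraph G).Adj S T → edgeRatio a S T * φ S = φ T)
    (hw : ∀ T v, w T v = a (g v T) v * (φ T / φ (g v T)))
    {S T : Triangle G} (hST : (derivedGraph G).Adj S T) :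
    ∑ v ∈ S.1, w T v = φ T / φ S := by
  have hr : φ T / φ S = edgeRatio a S T := by
    rw [div_eq_iff (hφ S).ne', hratio S T hST]
  have hsplit : ∀ v ∈ S.1, w T v = if v ∈ T.1 then a T v else a S v * (φ T / φ S) := by
    intro v hvS
    rw [hw]
    split_ifs with hvT
    · rw [(hg v).fixed T trivial hvT, div_self (hφ T).ne', mul_one]
    · rw [← (hg v).const S trivial T trivial hST fun h => hvT h.2, (hg v).fixed S trivial hvS]
  rw [Finset.sum_congr rfl hsplit, Finset.sum_ite, Finset.filter_mem_eq_inter, ← Finset.sum_mul]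
  have h1 : ∑ v ∈ S.1 ∩ T.1, a T v = (φ T / φ S) * ∑ v ∈ S.1 ∩ T.1, a S v := by
    rw [hr, edgeRatio, div_mul_cancel₀ _ (sum_inter_pos ha hpos hST).ne']
  have h2 := Finset.sum_filter_add_sum_filter_not S.1 (· ∈ T.1) (a S)
  rw [(ha S).2, Finset.filter_mem_eq_inter] at h2
  rw [h1, eq_sub_of_add_eq' h2]
  ring

/-- The unnormalized vectors are carried into multiples of each other by the local averaging steps:
on `S` by the choice of the ratios, and outside of `S` because adjacent triangles
have the same gates there. -/
lemma sum_unnormalized_mul_averagingStep [Fintype V] (ha : IsLocalWeight a)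
    (hpos : PosOnNonsimple a)
    (hg : ∀ v, IsGate Set.univ v (g v)) (hφ : ∀ T, 0 < φ T)
    (hratio : ∀ S T, (derivedGraph G).Adj S T → edgeRatio a S T * φ S = φ T)
    (hw : ∀ T v, w T v = a (g v T) v * (φ T / φ (g v T)))
    {S T : Triangle G} (hST : (derivedGraph G).Adj S T) (f : V → ℝ) :
    ∑ v, w T v * averagingStep a S f v = φ T / φ S * ∑ v, w S v * f v := by
  rw [← Finset.sum_add_sum_compl S.1, ← Finset.sum_add_sum_compl S.1 (fun v => w S v * f v),
    mul_add]
  congr 1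
  · have h1 : ∀ v ∈ S.1, w T v * averagingStep a S f v = w T v * average a S f := fun v hv => by
      rw [averagingStep_of_mem hv]
    have h2 : ∀ v ∈ S.1, w S v * f v = a S v * f v := fun v hv => by
      rw [hw, (hg v).fixed S trivial hv, div_self (hφ S).ne', mul_one]
    rw [Finset.sum_congr rfl h1, ← Finset.sum_mul,
      sum_unnormalized_eq_div ha hpos hg hφ hratio hw hST, Finset.sum_congr rfl h2]
    rfl
  · rw [Finset.mul_sum]
    refine Finset.sum_congr rfl fun v hv => ?_
    rw [Finset.mem_compl] at hv
    rw [averagingStep_of_notMem hv, hw, hw,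
      (hg v).const S trivial T trivial hST fun h => hv h.1]
    have := (hφ S).ne'
    field_simp

lemma isHarmonicFamily_normalize [Fintype V] (ha : IsLocalWeight a) (hpos : PosOnNonsimple a)
    (hg : ∀ v, IsGate Set.univ v (g v)) (hφ : ∀ T, 0 < φ T)
    (hratio : ∀ S T, (derivedGraph G).Adj S T → edgeRatio a S T * φ S = φ T)
    (hw : ∀ T v, w T v = a (g v T) v * (φ T / φ (g v T))) :
    IsHarmonicFamily a fun T => normalize (w T) := by
  have hsum := sum_unnormalized_pos ha hg hφ hw
  refine ⟨fun T => ⟨fun v => ?_, ?_⟩, fun S T hST => ?_, fun S T hST f => ?_⟩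
  · exact div_nonneg (unnormalized_nonneg ha hg hφ hw T v) (hsum T).le
  · simp only [normalize]
    rw [← Finset.sum_div, div_self (hsum T).ne']
  · simp only [normalize]
    rw [← Finset.sum_div, sum_unnormalized_eq_div ha hpos hg hφ hratio hw hST]
    exact div_pos (div_pos (hφ _) (hφ _)) (hsum T)
  · have key := sum_unnormalized_mul_averagingStep ha hpos hg hφ hratio hw hST
    have hone : averagingStep a S (fun _ => 1) = fun _ => 1 := by
      ext v
      simp [averagingStep, average, (ha S).2]
    have htot := key fun _ => 1
    simp only [hone, mul_one] at htot
    simp only [normalize, div_mul_eq_mul_div]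
    rw [← Finset.sum_div, ← Finset.sum_div, key, htot,
      mul_div_mul_left _ _ (div_pos (hφ T) (hφ S)).ne']

end Bottleneck

/-! ### Exhaustive walks and the limit -/

/-- In a connected graph with at least two nodes, a closed walk through all nodes can be traversed
periodically. -/
lemma exists_isExhaustiveWalk {W : Type*} [Finite W] {D : SimpleGraph W} (hD : D.Preconnected)
    {α β : W} (hαβ : α ≠ β) : ∃ γ : ℕ → W, IsExhaustiveWalk D γ ∧ γ 0 = α := by
  classical
  obtain ⟨_⟩ := nonempty_fintype W
  have hex : ∀ s : Finset W, ∃ p : D.Walk α α, ∀ x ∈ s, x ∈ p.support := by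
    intro s
    induction s using Finset.induction_on with
    | empty => exact ⟨.nil, by simp⟩
    | insert y s _ ih =>
      obtain ⟨p, hp⟩ := ih
      obtain ⟨q⟩ := hD α y
      refine ⟨(q.append q.reverse).append p, fun x hx => ?_⟩
      rw [SimpleGraph.Walk.mem_support_append_iff, SimpleGraph.Walk.mem_support_append_iff]
      rcases Finset.mem_insert.1 hx with rfl | hx
      · exact .inl (.inl q.end_mem_support)
      · exact .inr (hp x hx)
  obtain ⟨p, hp⟩ := hex Finset.univ
  have hlen : 0 < p.length := by
    by_contra h
    have hnil : p.Nil := SimpleGraph.Walk.length_eq_zero_iff.1 (by omega)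
    have := hp β (Finset.mem_univ β)
    rw [SimpleGraph.Walk.nil_iff_support_eq.1 hnil, List.mem_singleton] at this
    exact hαβ this.symm
  refine ⟨fun t => p.getVert (t % p.length), ⟨fun t => ?_, fun β N => ?_⟩, by simp⟩
  · change D.Adj (p.getVert (t % p.length)) (p.getVert ((t + 1) % p.length))
    have hlt := Nat.mod_lt t hlen
    have hadj := p.adj_getVert_succ hlt
    rcases Nat.lt_or_ge (t % p.length + 1) p.length with h | h
    · rwa [← Nat.mod_eq_of_lt h, Nat.mod_add_mod] at hadj
    · have hl : t % p.length + 1 = p.length := by omega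
      have hz : (t + 1) % p.length = 0 := by
        rw [← Nat.mod_add_mod, hl, Nat.mod_self]
      rw [hl, SimpleGraph.Walk.getVert_length] at hadj
      rwa [hz, SimpleGraph.Walk.getVert_zero]
  · obtain ⟨i, hi, hil⟩ := SimpleGraph.Walk.mem_support_iff_exists_getVert.1
      (hp β (Finset.mem_univ β))
    refine ⟨i + p.length * N, ?_, ?_⟩
    · exact (Nat.le_mul_of_pos_left N hlen).trans (Nat.le_add_left _ _)
    · simp only [Nat.add_mul_mod_self_left]
      rcases hil.lt_or_eq with h | h
      · rwa [Nat.mod_eq_of_lt h]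
      · rw [h, Nat.mod_self, SimpleGraph.Walk.getVert_zero, ← hi, h,
          SimpleGraph.Walk.getVert_length]

lemma IsHarmonicFamily.isLimitFamily {V : Type*} [Fintype V] [DecidableEq V] {G : SimpleGraph V}
    {a W : Triangle G → V → ℝ} (hW : IsHarmonicFamily a W) (ha : IsLocalWeight a)
    (hpos : PosOnNonsimple a) (hcover : Nonempty (Triangle G) → ∀ v : V, ∃ T : Triangle G, v ∈ T.1) :
    IsLimitFamily a W := by
  refine fun T => ⟨hW.mem_stdSimplex T, fun γ hγ h0 => ?_⟩
  refine tendsto_pi_nhds.2 fun j => tendsto_pi_nhds.2 fun k => ?_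
  have hz : ∀ t, (fun i => partialProduct a γ (t + 1) i k) =
      averagingStep a (γ t) fun i => partialProduct a γ t i k := by
    intro t
    rw [← localMatrix_mulVec]
    rfl
  have hlim := hW.tendsto_of_exhaustive (z := fun t i => partialProduct a γ t i k) ha (fun S T h => by
    rw [Finset.inter_comm]
    exact sum_inter_pos ha hpos h.symm) (hcover ⟨T⟩) hγ hz j
  simpa [partialProduct, Matrix.vecMulVec_apply, Matrix.one_apply, h0] using hlim

/-- What the two-tree structure of a triangulated Laman graph says about its triangles. -/
lemma IsTLG.exists_gates_potential {V : Type*} [Fintype V] [DecidableEq V] {G : SimpleGraph V}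
    (hG : IsTLG G) {a : Triangle G → V → ℝ} (ha : IsLocalWeight a) (hpos : PosOnNonsimple a) :
    (derivedGraph G).Preconnected ∧
    (Nonempty (Triangle G) → ∀ v : V, ∃ T : Triangle G, v ∈ T.1) ∧
    (∃ g : V → Triangle G → Triangle G, ∀ v, IsGate Set.univ v (g v)) ∧
    ∃ φ : Triangle G → ℝ, (∀ T, 0 < φ T) ∧
      ∀ S T, (derivedGraph G).Adj S T → edgeRatio a S T * φ S = φ T := by
  rcases isEmpty_or_nonempty (Triangle G) with hE | ⟨⟨T⟩⟩
  · exact ⟨fun S => hE.elim S, fun h => absurd h (not_nonempty_iff.2 hE),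
      ⟨fun _ => id, fun v => ⟨fun S => hE.elim S, fun S => hE.elim S, fun S => hE.elim S⟩⟩,
      fun _ => 1, fun S => hE.elim S, fun S => hE.elim S⟩
  · have hU := hG.isTwoTree_univ (by rw [← T.2.card_eq]; exact Finset.card_le_univ _)
    have hcover : ∀ v : V, ∃ T : Triangle G, v ∈ T.1 := fun v =>
      hU.exists_triangle_of_mem (Finset.mem_univ v)
    have huniv : {T : Triangle G | T.1 ⊆ Finset.univ} = Set.univ := by simp
    refine ⟨fun S T => hU.reachable S T (Finset.subset_univ _) (Finset.subset_univ _),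
      fun _ => hcover, ?_, ?_⟩
    · have hex : ∀ v, ∃ g, IsGate (Set.univ : Set (Triangle G)) v g := fun v => by
        obtain ⟨S, hS⟩ := hcover v
        have := hU.exists_isGate v ⟨S, Finset.subset_univ _, hS⟩
        rwa [huniv] at this
      choose g hg using hex
      exact ⟨g, hg⟩
    · obtain ⟨φ, hφ, h⟩ := hU.exists_potential fun S T => sum_inter_pos ha hpos
      exact ⟨φ, hφ, fun S T => h S T (Finset.subset_univ _) (Finset.subset_univ _)⟩

end TLG

theorem theorem4 {V : Type*} [Fintype V] [DecidableEq V] (G : SimpleGraph V) (hG : TLG.IsTLG G)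
    (a : TLG.Triangle G → V → ℝ) (ha : TLG.IsLocalWeight a) (hpos : TLG.PosOnNonsimple a) :
    -- bottlenecks exist and are unique
    (∀ (T : TLG.Triangle G) (v : V), ∃! B, TLG.IsBottleneck (TLG.derivedAt G v) T B) ∧
    -- any two triangles are joined by a walk, and the product of ratios depends only on its ends
    (TLG.derivedGraph G).Preconnected ∧
    (∀ (S T : TLG.Triangle G) (p q : (TLG.derivedGraph G).Walk S T),
      TLG.walkRatio a p = TLG.walkRatio a q) ∧
    -- so the construction of the unnormalized vectors yields exactly one family
    (∃! w : TLG.Triangle G → V → ℝ, TLG.IsUnnormalizedFamily a w) ∧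
    -- and its normalization is the family of limit vectors
    ∀ w : TLG.Triangle G → V → ℝ, TLG.IsUnnormalizedFamily a w →
      (∀ T v, 0 ≤ w T v) ∧ (∀ T, 0 < ∑ v, w T v) ∧
      TLG.IsLimitFamily a (fun T => TLG.normalize (w T)) ∧
      (4 ≤ Fintype.card V → ∀ wbar : TLG.Triangle G → V → ℝ, TLG.IsLimitFamily a wbar →
        ∀ T, wbar T = TLG.normalize (w T)) := by
  obtain ⟨hD, hcover, ⟨g, hg⟩, φ, hφ, hratio⟩ := hG.exists_gates_potential ha hpos
  have hiff := TLG.isUnnormalizedFamily_iff hD hg hφ hratio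
  refine ⟨fun T v => ⟨g v T, (hg v).isBottleneck T, fun B hB => hB.eq hD ((hg v).isBottleneck T)⟩,
    hD, fun S T p q => ?_, ⟨fun T v => a (g v T) v * (φ T / φ (g v T)), (hiff _).2 fun _ _ => rfl,
      fun w hw => funext₂ ((hiff w).1 hw)⟩, fun w hw' => ?_⟩
  · rw [TLG.walkRatio_eq_div hφ hratio, TLG.walkRatio_eq_div hφ hratio]
  have hw := (hiff w).1 hw'
  have hlim := (TLG.isHarmonicFamily_normalize ha hpos hg hφ hratio hw).isLimitFamily
    ha hpos hcover
  refine ⟨TLG.unnormalized_nonneg ha hg hφ hw, TLG.sum_unnormalized_pos ha hg hφ hw, hlim,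
    fun h4 wbar hwbar T => ?_⟩
  -- a vertex outside of `T` lies in another triangle, so there is an exhaustive walk from `T`
  obtain ⟨v, hv⟩ : ∃ v, v ∉ T.1 := by
    by_contra! h
    have h3 := T.2.card_eq
    rw [Finset.eq_univ_iff_forall.2 h, Finset.card_univ] at h3
    omega
  obtain ⟨S, hS⟩ := hcover ⟨T⟩ v
  obtain ⟨γ, hγ, h0⟩ := TLG.exists_isExhaustiveWalk hD (α := T) (β := S)
    fun h => hv (h ▸ hS)
  have heq := tendsto_nhds_unique ((hwbar T).2 γ hγ h0) ((hlim T).2 γ hγ h0)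
  ext k
  simpa [Matrix.vecMulVec_apply] using congrFun (congrFun heq v) k
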